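/- Let $p$ be a prime and let $\mathcal H$ be a $p$-dimensional complex Hilbert space. A SIC POVM in $\mathcal H$ consists of the $p^2$ outcomes $\frac1p|\psi_j\rangle\langle\psi_j|$, where the vectors $\psi_1,\dots,\psi_{p^2}\in\mathcal H$ satisfy $|\langle\psi_j|\psi_k\rangle|^2=\frac{1+p\,\delta_{jk}}{p+1}$ for all $j,k$. Its symmetry group $G_{\mathrm{sym}}$ is the group of unitary operators of determinant $1$ on $\mathcal H$ that permute the vectors $\psi_j$ up to phase factors. A group $G$ of unitary operators that permute the $\psi_j$ up to phase factors is said to make the SIC POVM covariant with respect to $G$ if the $\psi_j$ form a single orbit under $G$ (up to phase factors). The SIC POVM is group covariant if it is covariant with respect to the group of all unitary operators that permute the $\psi_j$ up to phase factors (equivalently, with respect to $G_{\mathrm{sym}}$). Let $X e_r=e_{r+1 \bmod p}$ and $Z e_r=e^{2\pi i r/p}e_r$ $(0\le r<p)$ on $\mathbb C^p$. The standard Heisenberg--Weyl (HW) group $D_{\mathrm{std}}$, in unimodular form, is the group of all unitary operators of determinant $1$ on $\mathbb C^p$ that are equal, up to a phase factor, to an element of the group generated by $X$ and $Z$. An HW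 group is a group $D=V D_{\mathrm{std}} V^{-1}$ with $V:\mathbb C^p\to\mathcal H$ unitary. Then a SIC POVM in $\mathcal H$ is group covariant if and only if it is covariant with respect to some HW group $D\le G_{\mathrm{sym}}$. In particular, in every prime dimension a group covariant SIC POVM is necessarily covariant with respect to an HW group contained in its symmetry group. -/

import Mathlib

noncomputable section

namespace SIC

variable {H : Type*} [NormedAddCommGroup H] [InnerProductSpace ℂ H]

/-- The vectors `ψ j`, `j < d ^ 2`, of a `d`-dimensional Hilbert space determine a SIC POVM, with
outcomes `(1 / d) |ψ j⟩⟨ψ j|`, if `|⟨ψ j, ψ k⟩| ^ 2 = (1 + d δ_{jk}) / (d + 1)` for all `j, k`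
(for `j = k` this says that `ψ j` is a unit vector). That these outcomes sum to the identity is a
consequence, `IsSICPOVM.sum_outcomes` below. -/
structure IsSICPOVM (d : ℕ) (ψ : Fin (d ^ 2) → H) : Prop where
  finrank_eq : Module.finrank ℂ H = d
  overlap : ∀ j k, ‖inner ℂ (ψ j) (ψ k)‖ ^ 2 = (1 + (d : ℝ) * (if j = k then 1 else 0)) / (d + 1)

/-- The group of all unitary operators on `H` that permute the vectors `ψ j` up to phase factors.
The group of unitary operators of `H` is `H ≃ₗᵢ[ℂ] H`. -/
def unitarySymmetryGroup {ι : Type*} (ψ : ι → H) : Subgroup (H ≃ₗᵢ[ℂ] H) where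
  carrier := {U | ∃ σ : Equiv.Perm ι, ∀ j, ∃ c : ℂ, ‖c‖ = 1 ∧ U (ψ j) = c • ψ (σ j)}
  one_mem' := ⟨1, fun j => ⟨1, by simp⟩⟩
  mul_mem' := by
    rintro U V ⟨σ, hσ⟩ ⟨τ, hτ⟩
    refine ⟨σ * τ, fun j => ?_⟩
    obtain ⟨b, hb1, hb⟩ := hτ j
    obtain ⟨a, ha1, ha⟩ := hσ (τ j)
    refine ⟨b * a, by simp [ha1, hb1], ?_⟩
    simp [hb, ha, mul_smul]
  inv_mem' := by
    rintro U ⟨σ, hσ⟩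
    refine ⟨σ⁻¹, fun j => ?_⟩
    obtain ⟨c, hc1, hc⟩ := hσ (σ⁻¹ j)
    have hc0 : c ≠ 0 := by rintro rfl; simp at hc1
    refine ⟨c⁻¹, by simp [hc1], ?_⟩
    rw [show σ (σ⁻¹ j) = j by simp] at hc
    change U.symm (ψ j) = _
    rw [← U.symm_apply_apply (ψ (σ⁻¹ j)), hc, map_smul, inv_smul_smul₀ hc0]

/-- The unitary operators of determinant `1`. -/
def unimodularUnitary (H : Type*) [NormedAddCommGroup H] [InnerProductSpace ℂ H] :
    Subgroup (H ≃ₗᵢ[ℂ] H) where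
  carrier := {U | LinearMap.det (U.toLinearEquiv : H →ₗ[ℂ] H) = 1}
  one_mem' := LinearMap.det_id
  mul_mem' := by
    intro U V hU hV
    have h : ((U * V).toLinearEquiv : H →ₗ[ℂ] H) =
        (U.toLinearEquiv : H →ₗ[ℂ] H) ∘ₗ (V.toLinearEquiv : H →ₗ[ℂ] H) := rfl
    simp only [Set.mem_ofPred_eq] at hU hV ⊢
    rw [h, LinearMap.det_comp, hU, hV, one_mul]
  inv_mem' := by
    intro U hU
    simp only [Set.mem_ofPred_eq] at hU ⊢
    have h : (U.toLinearEquiv : H →ₗ[ℂ] H) ∘ₗ ((U⁻¹).toLinearEquiv : H →ₗ[ℂ] H) =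
        LinearMap.id := by
      ext x; exact U.apply_symm_apply x
    have h' := congrArg LinearMap.det h
    rwa [LinearMap.det_comp, hU, one_mul, LinearMap.det_id] at h'

/-- The symmetry group of a SIC POVM: the unimodular unitary operators that permute its vectors
up to phase factors. -/
def symmetryGroup {ι : Type*} (ψ : ι → H) : Subgroup (H ≃ₗᵢ[ℂ] H) :=
  unitarySymmetryGroup ψ ⊓ unimodularUnitary H

/-- The vectors `ψ j` are covariant with respect to the group `G` of unitary operators: `G` permutes
them up to phase factors, and they form a single orbit (up to phase factors) under `G`. -/
def IsCovariantUnder {ι : Type*} (G : Subgroup (H ≃ₗᵢ[ℂ] H)) (ψ : ι → H) : Prop :=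
  G ≤ unitarySymmetryGroup ψ ∧ ∀ j k, ∃ U ∈ G, ∃ c : ℂ, ‖c‖ = 1 ∧ U (ψ j) = c • ψ k

/-- Group covariance: the vectors form a single orbit under the group of all unitary operators that
leave the SIC POVM invariant. -/
def IsGroupCovariant {ι : Type*} (ψ : ι → H) : Prop :=
  IsCovariantUnder (unitarySymmetryGroup ψ) ψ

/-- The unimodular unitary group with the same collineation group as `G`: all unitary operators of
determinant `1` that differ from an element of `G` by a phase factor. -/
def unimodularForm (G : Subgroup (H ≃ₗᵢ[ℂ] H)) : Subgroup (H ≃ₗᵢ[ℂ] H) where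
  carrier := {U | U ∈ unimodularUnitary H ∧
    ∃ V ∈ G, ∃ c : ℂ, ‖c‖ = 1 ∧ ∀ x, U x = c • V x}
  one_mem' := ⟨one_mem _, 1, one_mem _, 1, by simp, fun x => by simp⟩
  mul_mem' := by
    rintro U U' ⟨hU, V, hV, c, hc1, hc⟩ ⟨hU', V', hV', c', hc1', hc'⟩
    refine ⟨mul_mem hU hU', V * V', mul_mem hV hV', c * c', by simp [hc1, hc1'], fun x => ?_⟩
    simp [hc, hc', mul_smul]
  inv_mem' := by
    rintro U ⟨hU, V, hV, c, hc1, hc⟩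
    have hc0 : c ≠ 0 := by rintro rfl; simp at hc1
    refine ⟨inv_mem hU, V⁻¹, inv_mem hV, c⁻¹, by simp [hc1], fun x => ?_⟩
    apply U.injective
    have h1 : U (U⁻¹ x) = x := U.apply_symm_apply x
    have h2 : V (V⁻¹ x) = x := V.apply_symm_apply x
    rw [h1, hc, map_smul, h2, smul_inv_smul₀ hc0]

/-- Multiplication by the phase factor `exp (i θ)` on `ℂ`. -/
def phase (θ : ℝ) : ℂ ≃ₗᵢ[ℂ] ℂ where
  toFun z := Complex.exp (θ * Complex.I) * z
  invFun z := (Complex.exp (θ * Complex.I))⁻¹ * z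
  map_add' := mul_add _
  map_smul' a z := by simp only [smul_eq_mul, RingHom.id_apply]; ring
  left_inv z := inv_mul_cancel_left₀ (Complex.exp_ne_zero _) z
  right_inv z := mul_inv_cancel_left₀ (Complex.exp_ne_zero _) z
  norm_map' z := by
    change ‖Complex.exp (θ * Complex.I) * z‖ = ‖z‖
    rw [norm_mul, Complex.norm_exp_ofReal_mul_I, one_mul]

/-- The clock operator `Z e_r = ω ^ r e_r`, `r = 0, …, d - 1`, where `ω = exp (2 π i / d)`. -/
def clock (d : ℕ) : EuclideanSpace ℂ (Fin d) ≃ₗᵢ[ℂ] EuclideanSpace ℂ (Fin d) :=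
  LinearIsometryEquiv.piLpCongrRight 2 fun r : Fin d => phase (2 * Real.pi * (r : ℕ) / d)

/-- The shift operator `X e_r = e_{r + 1}`, with addition modulo `d`. -/
def shift (d : ℕ) [NeZero d] : EuclideanSpace ℂ (Fin d) ≃ₗᵢ[ℂ] EuclideanSpace ℂ (Fin d) :=
  LinearIsometryEquiv.piLpCongrLeft 2 ℂ ℂ (Equiv.addRight (1 : Fin d))

theorem clock_single (d : ℕ) (r : Fin d) :
    clock d (EuclideanSpace.single r 1) =
      Complex.exp (2 * Real.pi * Complex.I / d) ^ (r : ℕ) • EuclideanSpace.single r (1 : ℂ) := by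
  ext s
  by_cases h : s = r
  · subst h
    simp only [clock, phase, LinearIsometryEquiv.piLpCongrRight_apply, PiLp.smul_apply,
      PiLp.single_apply, if_true, smul_eq_mul, mul_one, ← Complex.exp_nat_mul]
    change Complex.exp _ * _ = _
    simp only [mul_one]
    congr 1
    push_cast
    ring
  · simp [clock, phase, h]

theorem shift_single (d : ℕ) [NeZero d] (r : Fin d) :
    shift d (EuclideanSpace.single r 1) = EuclideanSpace.single (r + 1) (1 : ℂ) :=
  EuclideanSpace.piLpCongrLeft_single _ _ _

/-- The standard Heisenberg–Weyl group, in its unimodular form: the group generated by the shift and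
clock operators, with the phase factors adjusted so that all determinants are `1`. -/
def standardHWGroup (d : ℕ) [NeZero d] :
    Subgroup (EuclideanSpace ℂ (Fin d) ≃ₗᵢ[ℂ] EuclideanSpace ℂ (Fin d)) :=
  unimodularForm (Subgroup.closure {shift d, clock d})

/-- `D` is a Heisenberg–Weyl group: it is unitarily equivalent to the standard one, that is,
`D = V D_std V⁻¹` for a unitary map `V` from `ℂ ^ d` onto `H`. -/
def IsHWGroup (d : ℕ) [NeZero d] (D : Subgroup (H ≃ₗᵢ[ℂ] H)) : Prop :=
  ∃ V : EuclideanSpace ℂ (Fin d) ≃ₗᵢ[ℂ] H,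
    ∀ U : H ≃ₗᵢ[ℂ] H, U ∈ D ↔ (V.trans U).trans V.symm ∈ standardHWGroup d

/-- The outcomes `(1 / d) |ψ j⟩⟨ψ j|` of a SIC POVM sum to the identity. -/
theorem IsSICPOVM.sum_outcomes {d : ℕ} {ψ : Fin (d ^ 2) → H} (hd : d ≠ 0) (hψ : IsSICPOVM d ψ)
    (x : H) : ∑ j, (1 / d : ℂ) • inner ℂ (ψ j) x • ψ j = x := by
  have hfin : FiniteDimensional ℂ H :=
    Module.finite_of_finrank_pos (by rw [hψ.finrank_eq]; omega)
  have hdC : (d : ℂ) ≠ 0 := by exact_mod_cast hd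
  have hd1 : (d : ℂ) + 1 ≠ 0 := by exact_mod_cast Nat.succ_ne_zero d
  let b := stdOrthonormalBasis ℂ H
  let T : H →ₗ[ℂ] H :=
    { toFun := fun x => (∑ j, inner ℂ (ψ j) x • ψ j) - (d : ℂ) • x
      map_add' := fun x y => by
        simp only [inner_add_right, add_smul, Finset.sum_add_distrib, smul_add]; abel
      map_smul' := fun a x => by
        simp only [inner_smul_right, mul_smul, Finset.smul_sum, smul_sub, RingHom.id_apply]
        rw [smul_comm (d : ℂ) a x] }
  have hT : ∀ x, T x = (∑ j, inner ℂ (ψ j) x • ψ j) - (d : ℂ) • x := fun x => rfl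
  have hov : ∀ j k, inner ℂ (ψ j) (ψ k) * inner ℂ (ψ k) (ψ j) =
      (1 + (d : ℂ) * (if j = k then 1 else 0)) / (d + 1) := by
    intro j k
    rw [← inner_conj_symm (ψ k) (ψ j), RCLike.mul_conj]
    have := congrArg (fun t : ℝ => (t : ℂ)) (hψ.overlap j k)
    split_ifs at this ⊢ <;> simpa using this
  have hn : ∀ j, inner ℂ (ψ j) (ψ j) = (1 : ℂ) := by
    intro j
    have h := hψ.overlap j j
    simp only [if_true, mul_one] at h
    rw [add_comm, div_self (by positivity)] at h
    have h' : ‖ψ j‖ ^ 2 = 1 := by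
      have h2 : (‖ψ j‖ ^ 2) ^ 2 = 1 := by
        rw [inner_self_eq_norm_sq_to_K] at h
        simpa using h
      nlinarith [sq_nonneg ‖ψ j‖]
    rw [inner_self_eq_norm_sq_to_K]
    have := congrArg (fun t : ℝ => (t : ℂ)) h'
    simpa using this
  have e : ∀ i, inner ℂ (T (b i)) (T (b i)) =
      (∑ j, ∑ k, inner ℂ (ψ j) (ψ k) * (inner ℂ (ψ k) (b i) * inner ℂ (b i) (ψ j)))
      - 2 * d * (∑ j, inner ℂ (ψ j) (b i) * inner ℂ (b i) (ψ j)) + d ^ 2 := by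
    intro i
    have hb : inner ℂ (b i) (b i) = (1 : ℂ) := by
      rw [inner_self_eq_norm_sq_to_K, b.norm_eq_one]; simp
    rw [hT]
    simp only [inner_sub_left, inner_sub_right, sum_inner, inner_sum, inner_smul_left,
      inner_smul_right, hb, inner_conj_symm, Complex.conj_natCast, mul_sub, Finset.mul_sum,
      Finset.sum_sub_distrib]
    have e1 : ∑ j, ∑ k, inner ℂ (ψ j) (b i) * (inner ℂ (b i) (ψ k) * inner ℂ (ψ k) (ψ j)) =
        ∑ j, ∑ k, inner ℂ (ψ j) (ψ k) * (inner ℂ (ψ k) (b i) * inner ℂ (b i) (ψ j)) := by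
      rw [Finset.sum_comm]
      exact Finset.sum_congr rfl fun j _ => Finset.sum_congr rfl fun k _ => by ring
    rw [e1, sub_sub, sub_add, ← add_sub_assoc, ← Finset.sum_add_distrib]
    have e2 : ∀ A B C D : ℂ, B = C → D = d ^ 2 → A - (B - D) = A - (C - d ^ 2) := by
      intro A B C D h h'; rw [h, h']
    exact e2 _ _ _ _ (Finset.sum_congr rfl fun j _ => by ring) (by ring)
  have key : ∑ i, inner ℂ (T (b i)) (T (b i)) = (0 : ℂ) := by
    have hsum : ∀ u v : H, ∑ i, inner ℂ u (b i) * inner ℂ (b i) v = inner ℂ u v :=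
      b.sum_inner_mul_inner
    have h1 : ∑ i, ∑ j, ∑ k, inner ℂ (ψ j) (ψ k) * (inner ℂ (ψ k) (b i) * inner ℂ (b i) (ψ j))
        = (d : ℂ) ^ 3 := by
      rw [Finset.sum_comm]
      have : ∀ j, ∑ i, ∑ k, inner ℂ (ψ j) (ψ k) * (inner ℂ (ψ k) (b i) * inner ℂ (b i) (ψ j))
          = (d : ℂ) := by
        intro j
        rw [Finset.sum_comm]
        simp only [← Finset.mul_sum, hsum, hov, mul_ite, mul_one, mul_zero, ← Finset.sum_div,
          Finset.sum_add_distrib, Finset.sum_ite_eq, Finset.mem_univ, if_true]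
        simp
        field_simp
      simp only [this]
      simp
      ring
    have h2 : ∑ i, ∑ j, inner ℂ (ψ j) (b i) * inner ℂ (b i) (ψ j) = (d : ℂ) ^ 2 := by
      rw [Finset.sum_comm]
      simp only [hsum, hn]
      simp
    simp only [e, Finset.sum_add_distrib, Finset.sum_sub_distrib, ← Finset.mul_sum, h1, h2]
    simp [hψ.finrank_eq]
    ring
  have hTb : ∀ i, T (b i) = 0 := by
    have h0 : ∑ i, ‖T (b i)‖ ^ 2 = 0 := by
      have h := congrArg Complex.re key
      simpa [inner_self_eq_norm_sq_to_K, ← Complex.ofReal_pow] using h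
    intro i
    have := (Finset.sum_eq_zero_iff_of_nonneg (fun i _ => sq_nonneg ‖T (b i)‖)).1 h0 i
      (Finset.mem_univ i)
    simpa using this
  have hT0 : T = 0 := b.toBasis.ext fun i => by simpa using hTb i
  have hx := hT x
  rw [hT0, LinearMap.zero_apply] at hx
  rw [← Finset.smul_sum, sub_eq_zero.1 hx.symm, smul_smul, one_div, inv_mul_cancel₀ hdC, one_smul]

end SIC

end

/-!
One direction is immediate. For the other, let `G` be the symmetry group of a group covariant SIC
POVM in dimension `p`. The projectors `|ψ j⟩⟨ψ j|` form a basis of the operators on `H`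
(`IsSICPOVM.projectorBasis`), and no two of the `ψ j` are orthogonal; this gives three facts.

* A symmetry that fixes all the lines `ℂ ψ j` is a scalar, so `G` is finite
  (`IsSICPOVM.finite_symmetryGroup`).
* An operator that commutes with a group of symmetries acting transitively on the lines is a scalar
  (`IsSICPOVM.exists_eq_smul_of_commute`).
* The number of lines fixed by a symmetry `W` is the trace of `T ↦ W T W⁻¹`. It is zero as soon as
  `W` commutes with some unitary operator up to a scalar other than `1` (`IsSICPOVM.not_fixed`).

Since `G` is transitive on `p ^ 2` lines, so is a Sylow `p`-subgroup `P` of `G`. The centre of `P`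
then consists of scalars with `p`-th power `1`, and `P` is not its own centre. An element `A` of the
second centre outside the centre has a partner `B` in `P` with `A B = ω B A` for a primitive `p`-th
root of unity `ω` (`IsSICPOVM.exists_commute_up_to_root`). By the Stone–von Neumann argument
(`exists_clock_shift`), a power of `A`, and `B`, are unitarily equivalent to the clock and shift
operators up to phase factors, so they generate a Heisenberg–Weyl group inside `G`. Finally, its
`p ^ 2` elements up to phase send a given `ψ j` to distinct lines, by the third fact, and hence to
all of them (`IsSICPOVM.exists_pow_mul_pow`).
-/

noncomputable section

namespace SIC

open Module

variable {H : Type*} [NormedAddCommGroup H] [InnerProductSpace ℂ H]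

/-! ### The outcomes of a SIC POVM as a basis of the operators -/

/-- The operator `|x⟩⟨x|`, the orthogonal projection onto the line of `x` if `x` is a unit vector. -/
def projector (x : H) : End ℂ H := (innerₛₗ ℂ x).smulRight x

theorem projector_apply (x y : H) : projector x y = inner ℂ x y • x := rfl

theorem projector_smul {c : ℂ} (hc : ‖c‖ = 1) (x : H) : projector (c • x) = projector x := by
  ext y
  simp only [projector_apply, inner_smul_left, smul_smul]
  congr 1
  rw [mul_right_comm, Complex.conj_mul', hc]
  simp

theorem conj_projector (U : H ≃ₗᵢ[ℂ] H) (x : H) :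
    U.toLinearEquiv.conj (projector x) = projector (U x) := by
  ext y
  rw [LinearEquiv.conj_apply_apply, projector_apply, projector_apply, map_smul]
  congr 1
  exact (U.inner_map_eq_flip x y).symm

theorem ne_zero_of_norm_one {c : ℂ} (hc : ‖c‖ = 1) : c ≠ 0 := by
  rintro rfl
  simp at hc

section

variable {d : ℕ} {ψ : Fin (d ^ 2) → H}

namespace IsSICPOVM

theorem inner_mul_inner (hψ : IsSICPOVM d ψ) (j k : Fin (d ^ 2)) :
    inner ℂ (ψ j) (ψ k) * inner ℂ (ψ k) (ψ j) =
      (1 + (d : ℂ) * (if j = k then 1 else 0)) / (d + 1) := by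
  rw [← inner_conj_symm (ψ k) (ψ j), RCLike.mul_conj]
  have := congrArg (fun t : ℝ => (t : ℂ)) (hψ.overlap j k)
  split_ifs at this ⊢ <;> simpa using this

theorem inner_ne_zero (hψ : IsSICPOVM d ψ) (j k : Fin (d ^ 2)) : inner ℂ (ψ j) (ψ k) ≠ 0 := by
  intro h
  have := hψ.overlap j k
  rw [h, norm_zero, zero_pow two_ne_zero] at this
  have h2 : (0 : ℝ) < (1 + (d : ℝ) * (if j = k then 1 else 0)) / (d + 1) := by
    split_ifs <;> positivity
  exact h2.ne this

variable [NeZero d]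

theorem finiteDimensional (hψ : IsSICPOVM d ψ) : FiniteDimensional ℂ H :=
  Module.finite_of_finrank_pos (by rw [hψ.finrank_eq]; exact NeZero.pos d)

theorem eq_of_eq_smul (hψ : IsSICPOVM d ψ) {j k : Fin (d ^ 2)} {c : ℂ} (hc : ‖c‖ = 1)
    (h : ψ j = c • ψ k) : j = k := by
  by_contra hjk
  have h1 := hψ.overlap j k
  have h2 := hψ.overlap k k
  rw [h, inner_smul_left, norm_mul, RCLike.norm_conj, hc, one_mul, h2] at h1
  have hd : (0 : ℝ) < d := by exact_mod_cast NeZero.pos d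
  rw [if_pos rfl, if_neg hjk, div_left_inj' (by positivity)] at h1
  linarith

/-- A linear combination of the outcomes is determined by its expectation values in the vectors
`ψ k`: the Gram matrix of the outcomes is invertible. -/
theorem coeff_eq_zero (hψ : IsSICPOVM d ψ) (g : Fin (d ^ 2) → ℂ)
    (h : ∀ k, inner ℂ (ψ k) ((∑ j, g j • projector (ψ j)) (ψ k)) = 0) (k : Fin (d ^ 2)) :
    g k = 0 := by
  have hd : (d : ℂ) ≠ 0 := NeZero.ne _
  have hd1 : (d : ℂ) + 1 ≠ 0 := by exact_mod_cast Nat.succ_ne_zero d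
  have key : ∀ k, (∑ j, g j) + d * g k = 0 := by
    intro k
    have h1 := h k
    simp only [LinearMap.sum_apply, LinearMap.smul_apply, projector_apply, inner_sum,
      inner_smul_right, hψ.inner_mul_inner] at h1
    have h2 : ∀ j, g j * ((1 + (d : ℂ) * (if j = k then 1 else 0)) / (d + 1)) =
        (g j + d * (if j = k then g j else 0)) / (d + 1) := by
      intro j
      split_ifs <;> ring
    simp only [h2] at h1
    rw [← Finset.sum_div, Finset.sum_add_distrib, ← Finset.mul_sum, Finset.sum_ite_eq' Finset.univ,
      if_pos (Finset.mem_univ k), div_eq_zero_iff] at h1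
    exact h1.resolve_right hd1
  have hsum : ∑ j, g j = 0 := by
    have h3 : ∑ k, ((∑ j, g j) + d * g k) = 0 := Finset.sum_eq_zero fun k _ => key k
    rw [Finset.sum_add_distrib, ← Finset.mul_sum, Finset.sum_const, Finset.card_univ,
      Fintype.card_fin, nsmul_eq_mul] at h3
    have h4 : (d : ℂ) * (d + 1) * ∑ j, g j = 0 := by
      push_cast at h3
      linear_combination h3
    exact (mul_eq_zero.1 h4).resolve_left (mul_ne_zero hd hd1)
  have := key k
  rw [hsum, zero_add] at this
  exact (mul_eq_zero.1 this).resolve_left hd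

theorem linearIndependent_projector (hψ : IsSICPOVM d ψ) :
    LinearIndependent ℂ fun j => projector (ψ j) := by
  rw [Fintype.linearIndependent_iff]
  intro g hg
  exact hψ.coeff_eq_zero g fun k => by rw [hg, LinearMap.zero_apply, inner_zero_right]

/-- The `d ^ 2` projectors `|ψ j⟩⟨ψ j|` form a basis of the operators on `H` (informational
completeness of the SIC POVM). -/
def projectorBasis (hψ : IsSICPOVM d ψ) : Basis (Fin (d ^ 2)) ℂ (End ℂ H) :=
  haveI := hψ.finiteDimensional
  basisOfLinearIndependentOfCardEqFinrank hψ.linearIndependent_projector (by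
    rw [Fintype.card_fin, Module.finrank_linearMap, hψ.finrank_eq, sq])

theorem projectorBasis_apply (hψ : IsSICPOVM d ψ) (j : Fin (d ^ 2)) :
    hψ.projectorBasis j = projector (ψ j) := by
  simp [projectorBasis]

theorem eq_zero_of_inner_eq_zero (hψ : IsSICPOVM d ψ) (T : End ℂ H)
    (h : ∀ j, inner ℂ (ψ j) (T (ψ j)) = 0) : T = 0 := by
  have hT : ∑ j, hψ.projectorBasis.repr T j • projector (ψ j) = T := by
    simpa only [projectorBasis_apply] using hψ.projectorBasis.sum_repr T
  have h0 := hψ.coeff_eq_zero (fun j => hψ.projectorBasis.repr T j) fun k => by rw [hT, h k]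
  rw [← hT]
  exact Finset.sum_eq_zero fun j _ => by rw [h0 j, zero_smul]

/-- Irreducibility of a group that acts transitively on the lines of the `ψ j`: an operator that
commutes with it is a scalar, as all its expectation values `⟨ψ j, T ψ j⟩` coincide. -/
theorem exists_eq_smul_of_commute (hψ : IsSICPOVM d ψ) (G : Set (H ≃ₗᵢ[ℂ] H))
    (hG : ∀ j k, ∃ U ∈ G, ∃ c : ℂ, ‖c‖ = 1 ∧ U (ψ j) = c • ψ k) (T : End ℂ H)
    (hT : ∀ U ∈ G, ∀ x, T (U x) = U (T x)) : ∃ c : ℂ, ∀ x, T x = c • x := by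
  have j₀ : Fin (d ^ 2) := ⟨0, pow_pos (NeZero.pos d) 2⟩
  have hc : ∀ k, inner ℂ (ψ k) (T (ψ k)) = inner ℂ (ψ j₀) (T (ψ j₀)) := by
    intro k
    obtain ⟨U, hU, c, hc, h⟩ := hG j₀ k
    rw [← U.inner_map_map (ψ j₀), ← hT U hU, h, map_smul, inner_smul_left, inner_smul_right,
      ← mul_assoc, Complex.conj_mul', hc]
    simp
  have hn : ∀ k, inner ℂ (ψ k) (ψ k) = (1 : ℂ) := by
    intro k
    have h1 : ‖ψ k‖ = 1 := by
      have h := hψ.overlap k k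
      rw [if_pos rfl, mul_one, add_comm, div_self (by positivity), inner_self_eq_norm_sq_to_K] at h
      have h2 : ‖ψ k‖ ^ 4 = 1 := by
        rw [← h]; simp; ring
      exact (pow_eq_one_iff_of_nonneg (norm_nonneg _) (by norm_num)).1 h2
    rw [inner_self_eq_norm_sq_to_K, h1]
    simp
  refine ⟨inner ℂ (ψ j₀) (T (ψ j₀)), fun x => ?_⟩
  have h0 := hψ.eq_zero_of_inner_eq_zero (T - inner ℂ (ψ j₀) (T (ψ j₀)) • 1) fun k => by
    rw [LinearMap.sub_apply, inner_sub_right, hc k, LinearMap.smul_apply, Module.End.one_apply,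
      inner_smul_right, hn k, mul_one, sub_self]
  have := LinearMap.congr_fun h0 x
  rwa [LinearMap.sub_apply, LinearMap.smul_apply, Module.End.one_apply, LinearMap.zero_apply,
    sub_eq_zero] at this

/-- A symmetry that fixes every line `ℂ ψ j` is a scalar: no two of the `ψ j` are orthogonal, so
that the phase factors coincide, and the `ψ j` span the space. -/
theorem exists_eq_smul_of_fixes (hψ : IsSICPOVM d ψ) (U : H ≃ₗᵢ[ℂ] H)
    (h : ∀ j, ∃ c : ℂ, ‖c‖ = 1 ∧ U (ψ j) = c • ψ j) : ∃ c : ℂ, ‖c‖ = 1 ∧ ∀ x, U x = c • x := by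
  choose c hc h using h
  have j₀ : Fin (d ^ 2) := ⟨0, pow_pos (NeZero.pos d) 2⟩
  have hconst : ∀ j, c j = c j₀ := by
    intro j
    have h1 := U.inner_map_map (ψ j₀) (ψ j)
    rw [h, h, inner_smul_left, inner_smul_right, ← mul_assoc] at h1
    have h2 := mul_right_cancel₀ (hψ.inner_ne_zero j₀ j) (h1.trans (one_mul _).symm)
    have h3 : (starRingEnd ℂ) (c j₀) * c j₀ = 1 := by
      rw [Complex.conj_mul', hc]; simp
    exact mul_left_cancel₀ (left_ne_zero_of_mul_eq_one h3) (h2.trans h3.symm)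
  refine ⟨c j₀, hc j₀, fun x => ?_⟩
  rw [← hψ.sum_outcomes (NeZero.ne d) x]
  simp only [map_sum, map_smul, h, hconst, Finset.smul_sum]
  refine Finset.sum_congr rfl fun j _ => ?_
  rw [smul_comm (inner ℂ (ψ j) x), smul_comm (1 / d : ℂ)]

/-- The number of the lines `ℂ ψ j` that a symmetry `W` fixes is the trace of `T ↦ W T W⁻¹`, as this
map permutes the basis of the projectors. If `W` commutes with a unitary operator `B` up to a scalar
`ζ ≠ 1`, multiplication by `B` conjugates that map to a multiple of itself by a scalar other than
`1`; hence the trace is zero. -/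
theorem not_fixed (hψ : IsSICPOVM d ψ) {W : H ≃ₗᵢ[ℂ] H} (hW : W ∈ unitarySymmetryGroup ψ)
    (B : H ≃ₗᵢ[ℂ] H) {ζ : ℂ} (hζ : ζ ≠ 1) (hWB : ∀ x, W (B x) = ζ • B (W x))
    (j : Fin (d ^ 2)) {c : ℂ} (hc : ‖c‖ = 1) (hj : W (ψ j) = c • ψ j) : False := by
  obtain ⟨σ, hσ⟩ := hW
  have hperm : ∀ k, W.toLinearEquiv.conj (hψ.projectorBasis k) = hψ.projectorBasis (σ k) := by
    intro k
    obtain ⟨a, ha, h⟩ := hσ k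
    rw [projectorBasis_apply, projectorBasis_apply, conj_projector, h, projector_smul ha]
  have hσj : σ j = j := by
    obtain ⟨a, ha, h⟩ := hσ j
    rw [hj] at h
    refine (hψ.eq_of_eq_smul (c := c⁻¹ * a) (by simp [hc, ha]) ?_).symm
    rw [mul_smul, ← h, inv_smul_smul₀ (ne_zero_of_norm_one hc)]
  -- The trace in the basis of projectors counts fixed points.
  set Φ : End ℂ (End ℂ H) := (W.toLinearEquiv.conj : End ℂ H →ₗ[ℂ] End ℂ H) with hΦ
  have htr : LinearMap.trace ℂ (End ℂ H) Φ = ((Finset.univ.filter fun k => σ k = k).card : ℂ) := by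
    rw [LinearMap.trace_eq_matrix_trace ℂ hψ.projectorBasis, Matrix.trace, Finset.card_filter]
    push_cast
    refine Finset.sum_congr rfl fun k _ => ?_
    rw [Matrix.diag_apply, LinearMap.toMatrix_apply]
    change hψ.projectorBasis.repr (W.toLinearEquiv.conj (hψ.projectorBasis k)) k = _
    rw [hperm, Basis.repr_self, Finsupp.single_apply]
  -- Left multiplication by `B` conjugates `Φ` to `ζ • Φ`.
  let L : End ℂ (End ℂ H) := LinearMap.mulLeft ℂ (B.toLinearEquiv : H →ₗ[ℂ] H)
  let L' : End ℂ (End ℂ H) := LinearMap.mulLeft ℂ (B.symm.toLinearEquiv : H →ₗ[ℂ] H)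
  have hL : L' * L = 1 := by
    ext T x
    exact B.symm_apply_apply (T x)
  have hL2 : L * L' = 1 := by
    ext T x
    exact B.apply_symm_apply (T x)
  have hΦL : Φ * L = ζ • (L * Φ) := by
    ext T x
    exact hWB (T (W.symm x))
  have h1 : LinearMap.trace ℂ (End ℂ H) Φ = ζ * LinearMap.trace ℂ (End ℂ H) Φ := by
    calc LinearMap.trace ℂ (End ℂ H) Φ
        = LinearMap.trace ℂ (End ℂ H) (Φ * (L * L')) := by
          rw [hL2, mul_one]
      _ = LinearMap.trace ℂ (End ℂ H) (ζ • (L * (Φ * L'))) := by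
          rw [← mul_assoc, hΦL, smul_mul_assoc, mul_assoc]
      _ = ζ * LinearMap.trace ℂ (End ℂ H) Φ := by
          rw [map_smul, LinearMap.trace_mul_comm, mul_assoc, hL, mul_one, smul_eq_mul]
  have h2 : LinearMap.trace ℂ (End ℂ H) Φ = 0 := by
    have : (1 - ζ) * LinearMap.trace ℂ (End ℂ H) Φ = 0 := by linear_combination h1
    exact (mul_eq_zero.1 this).resolve_left (sub_ne_zero.2 hζ.symm)
  rw [htr, Nat.cast_eq_zero, Finset.card_eq_zero] at h2
  exact Finset.notMem_empty j (h2 ▸ Finset.mem_filter.2 ⟨Finset.mem_univ j, hσj⟩)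

end IsSICPOVM

end

/-! ### Sylow subgroups of a transitive group -/

/-- A Sylow `p`-subgroup of a finite group that acts transitively on a set of `p ^ n` points is
itself transitive. -/
theorem isPretransitive_sylow {G Ω : Type*} [Group G] [Finite G] [MulAction G Ω] [Finite Ω]
    [MulAction.IsPretransitive G Ω] {p n : ℕ} [Fact p.Prime] (hΩ : Nat.card Ω = p ^ n)
    (P : Sylow p G) : MulAction.IsPretransitive (P : Subgroup G) Ω := by
  have : Nonempty Ω := Nat.card_pos_iff.1 (hΩ ▸ pow_pos (Fact.out : p.Prime).pos n) |>.1
  obtain ⟨a⟩ := this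
  rw [MulAction.isPretransitive_iff_orbit_eq_univ a]
  -- The orbit of `a` under `P` has the index of the stabilizer in `P` as its size. Times the index of
  -- `P`, which is prime to `p`, that is a multiple of the index `p ^ n` of the stabilizer in `G`.
  have h1 : (MulAction.stabilizer G a).relIndex P = (MulAction.orbit (P : Subgroup G) a).ncard :=
    MulAction.index_stabilizer (P : Subgroup G) a
  have h2 : p ^ n ∣ (MulAction.stabilizer G a).relIndex P * (P : Subgroup G).index := by
    rw [← hΩ, ← MulAction.index_stabilizer_of_transitive G a, ← Subgroup.inf_relIndex_right,
      Subgroup.relIndex_mul_index inf_le_right]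
    exact Subgroup.index_dvd_of_le inf_le_left
  have h3 : p ^ n ∣ (MulAction.orbit (P : Subgroup G) a).ncard := by
    rw [← h1]
    refine Nat.Coprime.dvd_of_dvd_mul_right ?_ h2
    exact Nat.Coprime.pow_left n (((Fact.out : p.Prime).coprime_iff_not_dvd).2 P.not_dvd_index)
  refine Set.eq_of_subset_of_ncard_le (Set.subset_univ _) ?_
  rw [Set.ncard_univ, hΩ]
  exact Nat.le_of_dvd ((Set.ncard_pos).2 (MulAction.nonempty_orbit a)) h3

/-! ### Unitary operators up to phase factors -/

theorem exists_unimodular [FiniteDimensional ℂ H] [Nontrivial H] (U : H ≃ₗᵢ[ℂ] H) :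
    ∃ U' ∈ unimodularUnitary H, ∃ c : ℂ, ‖c‖ = 1 ∧ ∀ x, U' x = c • U x := by
  have hdet : ‖LinearMap.det (U.toLinearEquiv : H →ₗ[ℂ] H)‖ = 1 := by
    rw [← LinearMap.normDet_eq_norm_det]
    exact U.toLinearIsometry.normDet_eq_one
  have hpos : 0 < finrank ℂ H := finrank_pos
  obtain ⟨c, hc⟩ := IsAlgClosed.exists_pow_nat_eq
    (LinearMap.det (U.toLinearEquiv : H →ₗ[ℂ] H))⁻¹ hpos
  have hc1 : ‖c‖ = 1 := by
    have := congrArg norm hc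
    rw [norm_pow, norm_inv, hdet, inv_one] at this
    exact (pow_eq_one_iff_of_nonneg (norm_nonneg _) hpos.ne').1 this
  have hcu : c ∈ unitary ℂ := by
    rw [Unitary.mem_iff_star_mul_self]
    simpa [hc1] using Complex.conj_mul' c
  refine ⟨(⟨c, hcu⟩ : unitary ℂ) • U, ?_, c, hc1, fun x => rfl⟩
  have h : (((⟨c, hcu⟩ : unitary ℂ) • U).toLinearEquiv : H →ₗ[ℂ] H) =
      c • (U.toLinearEquiv : H →ₗ[ℂ] H) := rfl
  change LinearMap.det _ = 1
  rw [h, LinearMap.det_smul, hc, inv_mul_cancel₀]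
  intro h0
  rw [h0, norm_zero] at hdet
  exact zero_ne_one hdet

theorem mem_unitarySymmetryGroup_of_eq_smul {ι : Type*} {ψ : ι → H} {U V : H ≃ₗᵢ[ℂ] H} {c : ℂ}
    (hc : ‖c‖ = 1) (h : ∀ x, U x = c • V x) (hV : V ∈ unitarySymmetryGroup ψ) :
    U ∈ unitarySymmetryGroup ψ := by
  obtain ⟨σ, hσ⟩ := hV
  refine ⟨σ, fun j => ?_⟩
  obtain ⟨a, ha, hj⟩ := hσ j
  exact ⟨c * a, by simp [hc, ha], by rw [h, hj, mul_smul]⟩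

section

variable {d : ℕ} {ψ : Fin (d ^ 2) → H}

namespace IsSICPOVM

theorem pow_eq_one_of_unimodular (hψ : IsSICPOVM d ψ) {U : H ≃ₗᵢ[ℂ] H}
    (hU : U ∈ unimodularUnitary H) {c : ℂ} (h : ∀ x, U x = c • x) : c ^ d = 1 := by
  have h1 : (U.toLinearEquiv : H →ₗ[ℂ] H) = c • LinearMap.id := LinearMap.ext h
  have h2 : LinearMap.det (U.toLinearEquiv : H →ₗ[ℂ] H) = 1 := hU
  rwa [h1, LinearMap.det_smul, LinearMap.det_id, mul_one, hψ.finrank_eq] at h2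

variable [NeZero d]

theorem nontrivial (hψ : IsSICPOVM d ψ) : Nontrivial H :=
  Module.nontrivial_of_finrank_pos (R := ℂ) (by rw [hψ.finrank_eq]; exact NeZero.pos d)

/-- Every unitary operator has a phase multiple of determinant `1`, so a group covariant SIC POVM is
covariant with respect to its symmetry group. -/
theorem exists_mem_symmetryGroup (hψ : IsSICPOVM d ψ) (h : IsGroupCovariant ψ)
    (j k : Fin (d ^ 2)) : ∃ U ∈ symmetryGroup ψ, ∃ c : ℂ, ‖c‖ = 1 ∧ U (ψ j) = c • ψ k := by
  have := hψ.finiteDimensional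
  have := hψ.nontrivial
  obtain ⟨V, hV, a, ha, hVj⟩ := h.2 j k
  obtain ⟨U, hU, c, hc, hUV⟩ := exists_unimodular V
  exact ⟨U, ⟨mem_unitarySymmetryGroup_of_eq_smul hc hUV hV, hU⟩, c * a, by simp [hc, ha],
    by rw [hUV, hVj, mul_smul]⟩

/-- The action of the symmetries on the lines of a SIC POVM. -/
def permHom (hψ : IsSICPOVM d ψ) : unitarySymmetryGroup ψ →* Equiv.Perm (Fin (d ^ 2)) :=
  MonoidHom.mk' (fun U => U.2.choose) fun U V => by
    ext1 j
    obtain ⟨a, ha, h1⟩ := (U * V).2.choose_spec j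
    obtain ⟨b, hb, h2⟩ := V.2.choose_spec j
    obtain ⟨c, hc, h3⟩ := U.2.choose_spec (V.2.choose j)
    have h4 : (U * V : H ≃ₗᵢ[ℂ] H) (ψ j) = b • c • ψ (U.2.choose (V.2.choose j)) := by
      rw [← h3, ← map_smul, ← h2]; rfl
    refine hψ.eq_of_eq_smul (c := a⁻¹ * (b * c)) (by simp [ha, hb, hc]) ?_
    rw [mul_smul, mul_smul, Equiv.Perm.mul_apply, ← h4]
    exact (inv_smul_eq_iff₀ (ne_zero_of_norm_one ha)).2 h1 |>.symm

theorem permHom_spec (hψ : IsSICPOVM d ψ) (U : unitarySymmetryGroup ψ) (j : Fin (d ^ 2)) :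
    ∃ c : ℂ, ‖c‖ = 1 ∧ (U : H ≃ₗᵢ[ℂ] H) (ψ j) = c • ψ (hψ.permHom U j) :=
  U.2.choose_spec j

theorem permHom_eq_iff (hψ : IsSICPOVM d ψ) (U : unitarySymmetryGroup ψ) (j k : Fin (d ^ 2)) :
    hψ.permHom U j = k ↔ ∃ c : ℂ, ‖c‖ = 1 ∧ (U : H ≃ₗᵢ[ℂ] H) (ψ j) = c • ψ k := by
  refine ⟨fun h => h ▸ hψ.permHom_spec U j, ?_⟩
  rintro ⟨c, hc, h⟩
  obtain ⟨a, ha, h1⟩ := hψ.permHom_spec U j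
  refine hψ.eq_of_eq_smul (c := a⁻¹ * c) (by simp [ha, hc]) ?_
  rw [mul_smul, ← h, h1, inv_smul_smul₀ (ne_zero_of_norm_one ha)]

/-- The symmetry group is finite: its elements that fix every line are scalars with determinant
`1`. -/
theorem finite_symmetryGroup (hψ : IsSICPOVM d ψ) : Finite (symmetryGroup ψ) := by
  let f : symmetryGroup ψ →* Equiv.Perm (Fin (d ^ 2)) :=
    hψ.permHom.comp (Subgroup.inclusion inf_le_left)
  have hker : ∀ U ∈ f.ker, ∃ c : ℂ, ∀ x, (U : H ≃ₗᵢ[ℂ] H) x = c • x := by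
    intro U hU
    obtain ⟨c, -, h⟩ := hψ.exists_eq_smul_of_fixes (U : H ≃ₗᵢ[ℂ] H) fun j =>
      (hψ.permHom_eq_iff (Subgroup.inclusion inf_le_left U) j j).1 (DFunLike.congr_fun hU j)
    exact ⟨c, h⟩
  have hfin : Finite f.ker := by
    choose! c hc using hker
    let g : f.ker → rootsOfUnity d ℂ := fun U =>
      rootsOfUnity.mkOfPowEq (c U) (hψ.pow_eq_one_of_unimodular U.1.2.2 (hc U U.2))
    refine Finite.of_injective g fun U V hUV => ?_
    have h1 : c U = c V := by
      simpa [g] using congrArg (fun z : rootsOfUnity d ℂ => ((z : ℂˣ) : ℂ)) hUV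
    ext x
    rw [hc U U.2, hc V V.2, h1]
  have hfin' : Finite (symmetryGroup ψ ⧸ f.ker) :=
    Finite.of_equiv _ (QuotientGroup.quotientKerEquivRange f).symm.toEquiv
  exact Finite.of_equiv _ (Subgroup.groupEquivQuotientProdSubgroup (s := f.ker)).symm

end IsSICPOVM

end

/-- The second centre of a Sylow `p`-subgroup of the symmetry group provides two unitary operators
that commute up to a primitive `p`-th root of unity. Indeed the Sylow subgroup is transitive on the
`p ^ 2` lines; so its centre consists of scalars, and the group is not its own centre. -/
theorem IsSICPOVM.exists_commute_up_to_root {p : ℕ} [hp : Fact p.Prime] {ψ : Fin (p ^ 2) → H}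
    (hψ : IsSICPOVM p ψ) (hcov : IsGroupCovariant ψ) :
    ∃ A ∈ symmetryGroup ψ, ∃ B ∈ symmetryGroup ψ, ∃ ω : ℂ, IsPrimitiveRoot ω p ∧
      ∀ x, A (B x) = ω • B (A x) := by
  have := hψ.finite_symmetryGroup
  let f : symmetryGroup ψ →* Equiv.Perm (Fin (p ^ 2)) :=
    hψ.permHom.comp (Subgroup.inclusion inf_le_left)
  have hf : ∀ (U : symmetryGroup ψ) j k, f U j = k ↔
      ∃ c : ℂ, ‖c‖ = 1 ∧ (U : H ≃ₗᵢ[ℂ] H) (ψ j) = c • ψ k := fun U j k =>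
    hψ.permHom_eq_iff (Subgroup.inclusion inf_le_left U) j k
  let _ : MulAction (symmetryGroup ψ) (Fin (p ^ 2)) := MulAction.compHom _ f
  have : MulAction.IsPretransitive (symmetryGroup ψ) (Fin (p ^ 2)) := ⟨fun j k => by
    obtain ⟨U, hU, h⟩ := hψ.exists_mem_symmetryGroup hcov j k
    exact ⟨⟨U, hU⟩, (hf ⟨U, hU⟩ j k).2 h⟩⟩
  obtain ⟨P⟩ : Nonempty (Sylow p (symmetryGroup ψ)) := inferInstance
  have htrans := isPretransitive_sylow (Nat.card_fin (p ^ 2)) P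
  have hP : ∀ j k, ∃ U : P, ∃ c : ℂ, ‖c‖ = 1 ∧ (U : H ≃ₗᵢ[ℂ] H) (ψ j) = c • ψ k := by
    intro j k
    obtain ⟨U, hU⟩ := htrans.exists_smul_eq j k
    exact ⟨U, (hf U j k).1 hU⟩
  have hcenter : ∀ T ∈ Subgroup.center P, ∃ c : ℂ, c ^ p = 1 ∧
      ∀ x, (T : H ≃ₗᵢ[ℂ] H) x = c • x := by
    intro T hT
    obtain ⟨c, hc⟩ := hψ.exists_eq_smul_of_commute
      (Set.range fun U : P => (U : H ≃ₗᵢ[ℂ] H))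
      (fun j k => by
        obtain ⟨U, h⟩ := hP j k
        exact ⟨_, ⟨U, rfl⟩, h⟩)
      ((T : H ≃ₗᵢ[ℂ] H).toLinearEquiv : H →ₗ[ℂ] H) (by
        rintro _ ⟨U, rfl⟩ x
        have := Subgroup.mem_center_iff.1 hT U
        exact (DFunLike.congr_fun
          (congrArg (fun V : P => ((V : symmetryGroup ψ) : H ≃ₗᵢ[ℂ] H)) this) x).symm)
    exact ⟨c, hψ.pow_eq_one_of_unimodular T.1.2.2 hc, hc⟩
  have hne : Nontrivial (P ⧸ Subgroup.center P) := by
    rw [QuotientGroup.nontrivial_iff]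
    intro htop
    have hlt : 1 < p ^ 2 := Nat.one_lt_pow two_ne_zero hp.out.one_lt
    obtain ⟨U, c, hc, hU⟩ := hP ⟨0, by omega⟩ ⟨1, hlt⟩
    obtain ⟨a, ha, haU⟩ := hcenter U (htop ▸ Subgroup.mem_top U)
    have ha1 : ‖a‖ = 1 := Complex.norm_eq_one_of_pow_eq_one ha hp.out.ne_zero
    rw [haU] at hU
    have := hψ.eq_of_eq_smul (j := ⟨0, by omega⟩) (k := ⟨1, hlt⟩) (c := a⁻¹ * c)
      (by simp [ha1, hc]) (by
        rw [mul_smul, ← hU, inv_smul_smul₀ (ne_zero_of_norm_one ha1)])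
    simp at this
  -- A nontrivial central element of the `p`-group `P / Z(P)` lifts to the second centre of `P`.
  obtain ⟨a, ha⟩ := @exists_ne _ (P.2.to_quotient (Subgroup.center P)).center_nontrivial
    (1 : Subgroup.center (P ⧸ Subgroup.center P))
  obtain ⟨A, hA⟩ := QuotientGroup.mk_surjective (a : P ⧸ Subgroup.center P)
  have hAc : A ∉ Subgroup.center P := by
    intro h
    apply ha
    ext1
    rw [← hA]
    exact (QuotientGroup.eq_one_iff A).2 h
  obtain ⟨B, hB⟩ : ∃ B : P, B * A ≠ A * B := by
    by_contra! h
    exact hAc (Subgroup.mem_center_iff.2 h)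
  have hcomm : A * B * (B * A)⁻¹ ∈ Subgroup.center P := by
    rw [← QuotientGroup.eq_one_iff, QuotientGroup.mk_mul, QuotientGroup.mk_inv,
      mul_inv_eq_one, QuotientGroup.mk_mul, QuotientGroup.mk_mul, hA]
    exact (Subgroup.mem_center_iff.1 a.2 B).symm
  obtain ⟨ω, hω, h⟩ := hcenter _ hcomm
  have hAB : ∀ x, (A : H ≃ₗᵢ[ℂ] H) ((B : H ≃ₗᵢ[ℂ] H) x) =
      ω • (B : H ≃ₗᵢ[ℂ] H) ((A : H ≃ₗᵢ[ℂ] H) x) := by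
    intro x
    rw [← h]
    have h1 : A * B = A * B * (B * A)⁻¹ * (B * A) := by group
    exact DFunLike.congr_fun
      (congrArg (fun V : P => ((V : symmetryGroup ψ) : H ≃ₗᵢ[ℂ] H)) h1) x
  have hω1 : ω ≠ 1 := by
    rintro rfl
    refine hB (Subtype.ext (Subtype.ext (LinearIsometryEquiv.ext fun x => ?_)))
    exact ((hAB x).trans (one_smul _ _)).symm
  exact ⟨A, A.1.2, B, B.1.2, ω, IsPrimitiveRoot.iff_orderOf.2 (orderOf_eq_prime hω hω1), hAB⟩

/-! ### Pairs of operators that commute up to a root of unity -/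

theorem unitary_mul_apply (U V : H ≃ₗᵢ[ℂ] H) (x : H) : (U * V) x = U (V x) := rfl

section

variable {A B : H ≃ₗᵢ[ℂ] H} {ω : ℂ}

theorem apply_pow_apply (h : ∀ x, A (B x) = ω • B (A x)) (n : ℕ) (x : H) :
    A ((B ^ n) x) = ω ^ n • (B ^ n) (A x) := by
  induction n generalizing x with
  | zero => simp
  | succ n ih =>
    rw [pow_succ, unitary_mul_apply, ih, h, map_smul, smul_smul, ← pow_succ,
      unitary_mul_apply]

theorem pow_apply_apply (h : ∀ x, A (B x) = ω • B (A x)) (n : ℕ) (x : H) :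
    (A ^ n) (B x) = ω ^ n • B ((A ^ n) x) := by
  induction n generalizing x with
  | zero => simp
  | succ n ih =>
    rw [pow_succ, unitary_mul_apply, h, map_smul, ih, smul_smul, ← pow_succ',
      unitary_mul_apply]

end

/-- The Stone–von Neumann theorem for a finite Heisenberg–Weyl group, in the form of its proof: the
vectors `B ^ r v`, `r < p`, for an eigenvector `v` of `A`, are eigenvectors of `A` with distinct
eigenvalues and hence an orthogonal basis, in which `A` and `B` are the clock and shift operators up
to phase factors. -/
theorem exists_clock_shift {d : ℕ} [NeZero d] (hd : finrank ℂ H = d) {A B : H ≃ₗᵢ[ℂ] H}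
    (h : ∀ x, A (B x) = Complex.exp (2 * Real.pi * Complex.I / d) • B (A x)) :
    ∃ V : EuclideanSpace ℂ (Fin d) ≃ₗᵢ[ℂ] H, ∃ a b : ℂ, ‖a‖ = 1 ∧ ‖b‖ = 1 ∧
      (∀ x, V (clock d x) = a • A (V x)) ∧ ∀ x, V (shift d x) = b • B (V x) := by
  have hfin : FiniteDimensional ℂ H :=
    Module.finite_of_finrank_pos (by rw [hd]; exact NeZero.pos d)
  have hnt : Nontrivial H :=
    Module.nontrivial_of_finrank_pos (R := ℂ) (by rw [hd]; exact NeZero.pos d)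
  set ω := Complex.exp (2 * Real.pi * Complex.I / d) with hωdef
  have hω : IsPrimitiveRoot ω d := Complex.isPrimitiveRoot_exp d (NeZero.ne d)
  obtain ⟨μ, hμ⟩ := Module.End.exists_eigenvalue (A.toLinearEquiv : H →ₗ[ℂ] H)
  obtain ⟨w, hw⟩ := hμ.exists_hasEigenvector
  have hw0 : ‖w‖ ≠ 0 := norm_ne_zero_iff.2 hw.2
  obtain ⟨v, hv1, hAv⟩ : ∃ v : H, ‖v‖ = 1 ∧ A v = μ • v := by
    refine ⟨(‖w‖⁻¹ : ℂ) • w, ?_, ?_⟩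
    · rw [norm_smul, norm_inv, Complex.norm_real, norm_norm, inv_mul_cancel₀ hw0]
    · rw [map_smul, smul_comm]
      exact congrArg _ hw.apply_eq_smul
  have hμ1 : ‖μ‖ = 1 := by
    have := A.norm_map v
    rwa [hAv, norm_smul, hv1, mul_one] at this
  have hA : ∀ n, A ((B ^ n) v) = (ω ^ n * μ) • (B ^ n) v := fun n => by
    rw [apply_pow_apply h, hAv, map_smul, smul_smul]
  have horth : ∀ m n, ω ^ m ≠ ω ^ n → inner ℂ ((B ^ m) v) ((B ^ n) v) = (0 : ℂ) := by
    intro m n hmn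
    have h1 := A.inner_map_map ((B ^ m) v) ((B ^ n) v)
    rw [hA, hA, inner_smul_left, inner_smul_right, ← mul_assoc] at h1
    by_contra h0
    have h2 := mul_right_cancel₀ h0 (h1.trans (one_mul _).symm)
    have h3 : ‖ω ^ m * μ‖ = 1 := by
      rw [norm_mul, norm_pow, hω.norm'_eq_one (NeZero.ne d), hμ1]; simp
    have h4 : (starRingEnd ℂ) (ω ^ m * μ) * (ω ^ m * μ) = 1 := by
      rw [Complex.conj_mul', h3]; simp
    have h5 := mul_left_cancel₀ (left_ne_zero_of_mul_eq_one h4) (h2.trans h4.symm)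
    exact hmn (mul_right_cancel₀ (ne_zero_of_norm_one hμ1) h5).symm
  have hn : ∀ n, ‖(B ^ n) v‖ = 1 := fun n => by rw [LinearIsometryEquiv.norm_map, hv1]
  -- `B ^ d v` is orthogonal to the `B ^ r v` with `0 < r < d`, so it is a multiple of `v`.
  have horn : Orthonormal ℂ fun r : Fin d => (B ^ (r : ℕ)) v :=
    ⟨fun r => hn r, fun r s hrs => horth r s fun h =>
      hrs (Fin.ext (hω.pow_inj r.2 s.2 h))⟩
  let e₀ : OrthonormalBasis (Fin d) ℂ H :=
    (basisOfOrthonormalOfCardEqFinrank horn (by rw [Fintype.card_fin, hd])).toOrthonormalBasis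
      (by rwa [coe_basisOfOrthonormalOfCardEqFinrank])
  have he₀ : ∀ r : Fin d, e₀ r = (B ^ (r : ℕ)) v := fun r => by simp [e₀]
  obtain ⟨β, hβ⟩ : ∃ β : ℂ, (B ^ d) v = β • v := by
    refine ⟨inner ℂ v ((B ^ d) v), ?_⟩
    rw [← e₀.sum_repr' ((B ^ d) v), Finset.sum_eq_single (0 : Fin d)]
    · simp [he₀, hv1]
    · intro r _ hr
      rw [he₀, horth, zero_smul]
      rw [hω.pow_eq_one]
      intro h1
      exact hr (Fin.ext (hω.pow_inj r.2 (NeZero.pos d) (by simpa using h1)))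
    · simp
  have hβ1 : ‖β‖ = 1 := by
    have := hn d
    rwa [hβ, norm_smul, hv1, mul_one] at this
  -- With this `b`, the `d`-th power of `b B` fixes `v`, so that `n ↦ (b B) ^ n v` has period `d`.
  obtain ⟨b, hb⟩ := IsAlgClosed.exists_pow_nat_eq β⁻¹ (NeZero.pos d)
  have hb1 : ‖b‖ = 1 := by
    have := congrArg norm hb
    rw [norm_pow, norm_inv, hβ1, inv_one] at this
    exact (pow_eq_one_iff_of_nonneg (norm_nonneg _) (NeZero.ne d)).1 this
  let f : ℕ → H := fun n => b ^ n • (B ^ n) v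
  have hfd : ∀ n, f (n + d) = f n := fun n => by
    simp only [f]
    rw [pow_add, pow_add, hb, unitary_mul_apply, hβ, map_smul, smul_smul, mul_assoc,
      inv_mul_cancel₀ (ne_zero_of_norm_one hβ1), mul_one]
  have hfmod : ∀ n, f (n % d) = f n := fun n => (Function.Periodic.map_mod_nat hfd n)
  have hforn : Orthonormal ℂ fun r : Fin d => f r := by
    refine ⟨fun r => by simp [f, norm_smul, hb1, hn], fun r s hrs => ?_⟩
    simp only [f]
    rw [inner_smul_left, inner_smul_right, horn.2 hrs, mul_zero, mul_zero]
  let e : OrthonormalBasis (Fin d) ℂ H :=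
    (basisOfOrthonormalOfCardEqFinrank hforn (by rw [Fintype.card_fin, hd])).toOrthonormalBasis
      (by rwa [coe_basisOfOrthonormalOfCardEqFinrank])
  have he : ∀ r : Fin d, e r = f r := fun r => by simp [e]
  have hV : ∀ r, e.repr.symm (EuclideanSpace.single r 1) = f r := fun r => by
    rw [OrthonormalBasis.repr_symm_single, he]
  have hext : ∀ S T : EuclideanSpace ℂ (Fin d) →ₗ[ℂ] H,
      (∀ r, S (EuclideanSpace.single r 1) = T (EuclideanSpace.single r 1)) → ∀ x, S x = T x := by
    intro S T hST x
    have : S = T := (EuclideanSpace.basisFun (Fin d) ℂ).toBasis.ext fun r => by simpa using hST r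
    rw [this]
  refine ⟨e.repr.symm, μ⁻¹, b, by simp [hμ1], hb1, ?_, ?_⟩
  · refine hext (e.repr.symm.toLinearEquiv.toLinearMap ∘ₗ (clock d).toLinearEquiv.toLinearMap)
      (μ⁻¹ • A.toLinearEquiv.toLinearMap ∘ₗ e.repr.symm.toLinearEquiv.toLinearMap) fun r => ?_
    change e.repr.symm (clock d (EuclideanSpace.single r 1)) =
      μ⁻¹ • A (e.repr.symm (EuclideanSpace.single r 1))
    rw [clock_single, map_smul, hV, ← hωdef]
    simp only [f]
    rw [map_smul, hA, smul_comm μ⁻¹, smul_smul, smul_smul, smul_smul]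
    congr 1
    field_simp [ne_zero_of_norm_one hμ1]
  · refine hext (e.repr.symm.toLinearEquiv.toLinearMap ∘ₗ (shift d).toLinearEquiv.toLinearMap)
      (b • B.toLinearEquiv.toLinearMap ∘ₗ e.repr.symm.toLinearEquiv.toLinearMap) fun r => ?_
    change e.repr.symm (shift d (EuclideanSpace.single r 1)) =
      b • B (e.repr.symm (EuclideanSpace.single r 1))
    rw [shift_single, hV, hV, Fin.val_add, hfmod, Fin.val_one', ← hfmod, Nat.add_mod_mod, hfmod]
    simp only [f]
    rw [map_smul, smul_smul, ← pow_succ', pow_succ' B, unitary_mul_apply]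

/-- The `d ^ 2` operators `A ^ m B ^ n` with `m, n < d` send `ψ j` to distinct lines, and hence to all
lines: if two of them send it to the same line, `IsSICPOVM.not_fixed` shows that they commute with
`A` and with `B` up to the same scalars `ω ^ (-n)` and `ω ^ m`. -/
theorem IsSICPOVM.exists_pow_mul_pow {d : ℕ} [NeZero d] {ψ : Fin (d ^ 2) → H}
    (hψ : IsSICPOVM d ψ) {A B : H ≃ₗᵢ[ℂ] H} (hA : A ∈ unitarySymmetryGroup ψ)
    (hB : B ∈ unitarySymmetryGroup ψ) {ω : ℂ} (hω : IsPrimitiveRoot ω d)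
    (h : ∀ x, A (B x) = ω • B (A x)) (j k : Fin (d ^ 2)) :
    ∃ m n : ℕ, ∃ c : ℂ, ‖c‖ = 1 ∧ (A ^ m * B ^ n) (ψ j) = c • ψ k := by
  have hω0 : ω ≠ 0 := hω.ne_zero (NeZero.ne d)
  have key : ∀ W₁ ∈ unitarySymmetryGroup ψ, ∀ W₂ ∈ unitarySymmetryGroup ψ, ∀ (C : H ≃ₗᵢ[ℂ] H)
      (ζ₁ ζ₂ : ℂ), ζ₁ ≠ 0 → (∀ x, W₁ (C x) = ζ₁ • C (W₁ x)) → (∀ x, W₂ (C x) = ζ₂ • C (W₂ x)) →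
      (∃ a₁ a₂ : ℂ, ‖a₁‖ = 1 ∧ ‖a₂‖ = 1 ∧ ∃ l, W₁ (ψ j) = a₁ • ψ l ∧ W₂ (ψ j) = a₂ • ψ l) →
      ζ₁ = ζ₂ := by
    rintro W₁ hW₁ W₂ hW₂ C ζ₁ ζ₂ hζ h1 h2 ⟨a₁, a₂, ha₁, ha₂, l, hl₁, hl₂⟩
    by_contra hne
    refine hψ.not_fixed (W := W₁⁻¹ * W₂) (mul_mem (inv_mem hW₁) hW₂) C (ζ := ζ₂ * ζ₁⁻¹) ?_ ?_ j
      (c := a₂ * a₁⁻¹) (by simp [ha₁, ha₂]) ?_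
    · intro h0
      rw [mul_inv_eq_one₀ hζ] at h0
      exact hne h0.symm
    · intro x
      apply W₁.injective
      change W₁ (W₁.symm (W₂ (C x))) = W₁ (_ • C (W₁.symm (W₂ x)))
      rw [map_smul, h1, W₁.apply_symm_apply, W₁.apply_symm_apply, h2, smul_smul, mul_assoc,
        inv_mul_cancel₀ hζ, mul_one]
    · apply W₁.injective
      change W₁ (W₁.symm (W₂ (ψ j))) = _
      rw [map_smul, W₁.apply_symm_apply, hl₁, hl₂, smul_smul, mul_assoc,
        inv_mul_cancel₀ (ne_zero_of_norm_one ha₁), mul_one]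
  have hmem : ∀ m n : ℕ, A ^ m * B ^ n ∈ unitarySymmetryGroup ψ := fun m n =>
    mul_mem (pow_mem hA m) (pow_mem hB n)
  let F : Fin d × Fin d → Fin (d ^ 2) := fun q => hψ.permHom ⟨_, hmem q.1 q.2⟩ j
  have hF : Function.Injective F := by
    rintro ⟨m, n⟩ ⟨m', n'⟩ hq
    obtain ⟨a₁, ha₁, h₁⟩ := hψ.permHom_spec ⟨_, hmem m n⟩ j
    obtain ⟨a₂, ha₂, h₂⟩ := hψ.permHom_spec ⟨_, hmem m' n'⟩ j
    have hl : ∃ a₁ a₂ : ℂ, ‖a₁‖ = 1 ∧ ‖a₂‖ = 1 ∧ ∃ l, (A ^ (m : ℕ) * B ^ (n : ℕ)) (ψ j) = a₁ • ψ l ∧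
        (A ^ (m' : ℕ) * B ^ (n' : ℕ)) (ψ j) = a₂ • ψ l :=
      ⟨a₁, a₂, ha₁, ha₂, F (m, n), h₁, hq ▸ h₂⟩
    have hcB : ∀ m n : ℕ, ∀ x, (A ^ m * B ^ n) (B x) = ω ^ m • B ((A ^ m * B ^ n) x) := by
      intro m n x
      rw [unitary_mul_apply, ← unitary_mul_apply (B ^ n), ← pow_succ,
        pow_succ', unitary_mul_apply, pow_apply_apply h, unitary_mul_apply]
    have hcA : ∀ m n : ℕ, ∀ x, (A ^ m * B ^ n) (A x) = (ω ^ n)⁻¹ • A ((A ^ m * B ^ n) x) := by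
      intro m n x
      rw [unitary_mul_apply, unitary_mul_apply,
        ← unitary_mul_apply A, ← pow_succ', pow_succ, unitary_mul_apply,
        apply_pow_apply h, map_smul, inv_smul_smul₀ (pow_ne_zero n hω0)]
    have e1 := key _ (hmem m n) _ (hmem m' n') B _ _ (pow_ne_zero _ hω0) (hcB m n) (hcB m' n') hl
    have e2 := key _ (hmem m n) _ (hmem m' n') A _ _ (inv_ne_zero (pow_ne_zero _ hω0)) (hcA m n)
      (hcA m' n') hl
    exact Prod.ext (Fin.ext (hω.pow_inj m.2 m'.2 e1))
      (Fin.ext (hω.pow_inj n.2 n'.2 (inv_injective e2)))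
  have hbij : Function.Bijective F :=
    (Fintype.bijective_iff_injective_and_card F).2 ⟨hF, by simp [sq]⟩
  obtain ⟨⟨m, n⟩, hq⟩ := hbij.2 k
  exact ⟨m, n, (hψ.permHom_eq_iff ⟨_, hmem m n⟩ j k).1 hq⟩

/-! ### The Heisenberg–Weyl group of a group covariant SIC POVM -/

/-- Two symmetries that commute up to a primitive root of unity generate, up to phase factors, a
Heisenberg–Weyl group for which the SIC POVM is covariant. -/
theorem IsSICPOVM.exists_isHWGroup {d : ℕ} [NeZero d] {ψ : Fin (d ^ 2) → H}
    (hψ : IsSICPOVM d ψ) {A B : H ≃ₗᵢ[ℂ] H} (hA : A ∈ unitarySymmetryGroup ψ)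
    (hB : B ∈ unitarySymmetryGroup ψ) {ω : ℂ} (hω : IsPrimitiveRoot ω d)
    (h : ∀ x, A (B x) = ω • B (A x)) :
    ∃ D : Subgroup (H ≃ₗᵢ[ℂ] H), D ≤ symmetryGroup ψ ∧ IsHWGroup d D ∧ IsCovariantUnder D ψ := by
  have := hψ.finiteDimensional
  have := hψ.nontrivial
  have hexp := Complex.isPrimitiveRoot_exp d (NeZero.ne d)
  -- A power of `A` has the commutation factor `exp (2 π i / d)` with `B`.
  obtain ⟨i, -, hi⟩ := hω.eq_pow_of_pow_eq_one hexp.pow_eq_one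
  have hAi : ∀ x, (A ^ i) (B x) = Complex.exp (2 * Real.pi * Complex.I / d) • B ((A ^ i) x) := by
    intro x
    rw [pow_apply_apply h, hi]
  obtain ⟨V, a, b, ha, hb, hVA, hVB⟩ := exists_clock_shift hψ.finrank_eq hAi
  -- Conjugation with `V` in both directions; `D` is the preimage of the standard group under `φ`.
  let φ : (H ≃ₗᵢ[ℂ] H) →* (EuclideanSpace ℂ (Fin d) ≃ₗᵢ[ℂ] EuclideanSpace ℂ (Fin d)) :=
    MonoidHom.mk' (fun U => (V.trans U).trans V.symm) fun U U' => by
      ext1 x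
      change V.symm (U (U' (V x))) = V.symm (U (V (V.symm (U' (V x)))))
      rw [V.apply_symm_apply]
  let φ' : (EuclideanSpace ℂ (Fin d) ≃ₗᵢ[ℂ] EuclideanSpace ℂ (Fin d)) →* (H ≃ₗᵢ[ℂ] H) :=
    MonoidHom.mk' (fun U => (V.symm.trans U).trans V) fun U U' => by
      ext1 x
      change V (U (U' (V.symm x))) = V (U (V.symm (V (U' (V.symm x)))))
      rw [V.symm_apply_apply]
  have hφφ' : ∀ U x, φ U (V.symm x) = V.symm (U x) := fun U x => by
    change V.symm (U (V (V.symm x))) = _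
    rw [V.apply_symm_apply]
  have hclock : φ' (clock d) ∈ unitarySymmetryGroup ψ :=
    mem_unitarySymmetryGroup_of_eq_smul ha (V := A ^ i) (fun x => by
      change V (clock d (V.symm x)) = _
      rw [hVA, V.apply_symm_apply]) (pow_mem hA i)
  have hshift : φ' (shift d) ∈ unitarySymmetryGroup ψ :=
    mem_unitarySymmetryGroup_of_eq_smul hb (V := B) (fun x => by
      change V (shift d (V.symm x)) = _
      rw [hVB, V.apply_symm_apply]) hB
  have hclosure : Subgroup.closure {shift d, clock d} ≤ (unitarySymmetryGroup ψ).comap φ' := by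
    rw [Subgroup.closure_le]
    rintro _ (rfl | rfl)
    · exact hshift
    · exact hclock
  have hdet : ∀ U : H ≃ₗᵢ[ℂ] H,
      φ U ∈ unimodularUnitary (EuclideanSpace ℂ (Fin d)) ↔ U ∈ unimodularUnitary H := by
    intro U
    have h1 := LinearMap.det_conj (U.toLinearEquiv : H →ₗ[ℂ] H) V.symm.toLinearEquiv
    change LinearMap.det _ = 1 ↔ LinearMap.det _ = 1
    rw [← h1]
    rfl
  have hsub : (standardHWGroup d).comap φ ≤ symmetryGroup ψ := by
    intro U hU
    obtain ⟨hU1, W, hW, c, hc, hUW⟩ := hU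
    refine ⟨mem_unitarySymmetryGroup_of_eq_smul hc (V := φ' W) (fun x => ?_) (hclosure hW),
      (hdet U).1 hU1⟩
    apply V.symm.injective
    rw [← hφφ', hUW, map_smul]
    change _ = c • V.symm (V (W (V.symm x)))
    rw [V.symm_apply_apply]
  refine ⟨(standardHWGroup d).comap φ, hsub, ⟨V, fun U => Iff.rfl⟩, hsub.trans inf_le_left, ?_⟩
  intro j k
  have hcs : ∀ x, φ' (clock d) (φ' (shift d) x) = Complex.exp (2 * Real.pi * Complex.I / d) •
      φ' (shift d) (φ' (clock d) x) := by
    intro x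
    change V (clock d (V.symm (V (shift d (V.symm x))))) =
      _ • V (shift d (V.symm (V (clock d (V.symm x)))))
    rw [V.symm_apply_apply, V.symm_apply_apply, hVA, hVB, hVB, hVA, V.apply_symm_apply, map_smul,
      map_smul, hAi, smul_comm a b, smul_comm a, smul_comm b]
  obtain ⟨m, n, c, hc, hmn⟩ := hψ.exists_pow_mul_pow hclock hshift hexp hcs j k
  obtain ⟨U, hU, c', hc', hUc⟩ := exists_unimodular (φ' (clock d) ^ m * φ' (shift d) ^ n)
  refine ⟨U, ⟨(hdet U).2 hU, clock d ^ m * shift d ^ n, mul_mem (pow_mem ?_ m) (pow_mem ?_ n), c',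
    hc', fun x => ?_⟩, c' * c, by simp [hc, hc'], by rw [hUc, hmn, mul_smul]⟩
  · exact Subgroup.subset_closure (by simp)
  · exact Subgroup.subset_closure (by simp)
  · change V.symm (U (V x)) = _
    rw [hUc, ← map_pow, ← map_pow, ← map_mul, map_smul]
    change c' • V.symm (V ((clock d ^ m * shift d ^ n) (V.symm (V x)))) = _
    rw [V.symm_apply_apply, V.symm_apply_apply]

end SIC

end

/-- In prime dimension `p`, a SIC POVM is group covariant if and only if it is covariant with
respect to a Heisenberg–Weyl group, that is, a subgroup of its symmetry group that is unitarily
equivalent to the standard Heisenberg–Weyl group. -/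
theorem lemma1 (p : ℕ) [Fact p.Prime] {H : Type*} [NormedAddCommGroup H] [InnerProductSpace ℂ H]
    (ψ : Fin (p ^ 2) → H) (hψ : SIC.IsSICPOVM p ψ) :
    SIC.IsGroupCovariant ψ ↔
      ∃ D : Subgroup (H ≃ₗᵢ[ℂ] H),
        D ≤ SIC.symmetryGroup ψ ∧ SIC.IsHWGroup p D ∧ SIC.IsCovariantUnder D ψ := by
  constructor
  · intro h
    obtain ⟨A, hA, B, hB, ω, hω, hAB⟩ := hψ.exists_commute_up_to_root h
    exact hψ.exists_isHWGroup hA.1 hB.1 hω hAB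
  · rintro ⟨D, -, -, hD, htrans⟩
    refine ⟨le_rfl, fun j k => ?_⟩
    obtain ⟨U, hU, h⟩ := htrans j k
    exact ⟨U, hD hU, h⟩
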